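/- Let $A_1\in\mathbb R^{n_1\times n_1}$, $L_1\in\mathbb R^{n_1\times p_2}$, $B_1\in\mathbb R^{n_1\times m_1}$, $A_2\in\mathbb R^{n_2\times n_2}$, $L_2\in\mathbb R^{n_2\times p_1}$, $\Gamma_1\in\mathbb R^{p_1\times n_1}$, $\Gamma_2\in\mathbb R^{p_2\times n_2}$, and suppose that $$A:=\begin{bmatrix}A_1&L_1\Gamma_2\\ L_2\Gamma_1&A_2\end{bmatrix}$$ is stable, i.e. all its eigenvalues have negative real part; a linear system $\dot x=Mx$ is called internally stable if $M$ is stable. Let $P_1\in\mathbb R^{n_1\times\hat n_1}$ and $\overline P_1\in\mathbb R^{n_1\times(n_1-\hat n_1)}$ be left invertible with left inverses $P_1^\dagger$, $\overline P_1^\dagger$ such that $P_1P_1^\dagger+\overline P_1\overline P_1^\dagger=I$. Consider the cascade system $$\dot{\hat\xi}_1=P_1^\dagger A_1P_1\hat\xi_1+P_1^\dagger B_1u_1,\qquad \begin{bmatrix}\dot\xi_1\\ \dot\xi_2\end{bmatrix}=A\begin{bmatrix}\xi_1\\ \xi_2\end{bmatrix}+\begin{bmatrix}\overline P_1\overline P_1^\dagger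 A_1\\ L_2\Gamma_1\end{bmatrix}P_1\hat\xi_1 \qquad (1)$$ with the local state feedback $u_1=\hat K_1\hat\xi_1$, where $\hat K_1\in\mathbb R^{m_1\times\hat n_1}$. (a) For every $\hat K_1$, the closed-loop system composed of (1) and $u_1=\hat K_1\hat\xi_1$ is internally stable if and only if $$\dot{\hat\xi}_1=(P_1^\dagger A_1P_1+P_1^\dagger B_1\hat K_1)\hat\xi_1 \qquad (2)$$ is internally stable. (b) Let $E_1=\begin{bmatrix}I\\0\end{bmatrix}$, $E_2=\begin{bmatrix}0\\I\end{bmatrix}$ and, for $i\in\{1,2\}$, $$G_i'(s):=E_i^{\sf T}(sI-A)^{-1}\{E_1\overline P_1\overline P_1^\dagger A_1+E_2L_2\Gamma_1\},$$ $$\alpha_1':=\|(G_1'+I)P_1\|_{\mathcal H_\infty},\qquad \alpha_2':=\|G_2'P_1\|_{\mathcal H_\infty},$$ $$\beta_i'(\delta_0,\zeta_0):=\bigl\|E_i^{\sf T}e^{At}E_1(\overline P_1\overline P_1^\dagger\delta_0+P_1P_1^\dagger\zeta_0)\bigr\|_{\mathcal L_2},\qquad \delta_0,\zeta_0\in\mathbb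 R^{n_1},$$ where $\mathcal L_2$-norms are over $[0,\infty)$. These are finite nonnegative constants and functions, which do not depend on $\hat K_1$. For every $\hat K_1$ and every $\epsilon_1>0$: if $\|\hat\xi_1\|_{\mathcal L_2}\le\epsilon_1$ holds for all solutions of (2) with $\hat\xi_1(0)\in\{P_1^\dagger\delta_0:\|\delta_0\|\le1\}$, then for all $\zeta_0\in\mathbb R^{n_1}$ and all $\delta_0\in\mathbb R^{n_1}$ with $\|\delta_0\|\le1$, the solution of (1) with $u_1=\hat K_1\hat\xi_1$ and the initial condition $$\hat\xi_1(0)=P_1^\dagger(\delta_0-\zeta_0),\qquad \xi_1(0)=\overline P_1\overline P_1^\dagger\delta_0+P_1P_1^\dagger\zeta_0,\qquad \xi_2(0)=0$$ satisfies $$\|\xi_1+P_1\hat\xi_1\|_{\mathcal L_2}\le\alpha_1'(1+\|\zeta_0\|)\epsilon_1+\beta_1'(\delta_0,\zeta_0),\qquad \|\xi_2\|_{\mathcal L_2}\le\alpha_2'(1+\|\zeta_0\|)\epsilon_1+\beta_2'(\delta_0,\zeta_0).$$ -/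

import Mathlib

namespace Retrofit

open Matrix MeasureTheory
open scoped ENNReal

noncomputable section

variable {σ τ ι κ : Type*} [Fintype σ] [Fintype τ] [Fintype ι] [Fintype κ]
  [DecidableEq σ] [DecidableEq τ]

/-! ### Linear time-invariant systems -/

/-- The Euclidean norm of a real coordinate vector. -/
def euclNorm (v : σ → ℝ) : ℝ := ‖WithLp.toLp 2 v‖

/-- The `L²` norm on the time axis `[0, ∞)` of a vector signal, with the Euclidean norm on vectors;
it is `∞` when the signal is not square-integrable. -/
def l2Norm (f : ℝ → σ → ℝ) : ℝ≥0∞ :=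
  eLpNorm (fun t => WithLp.toLp 2 (f t)) 2 (volume.restrict (Set.Ici (0 : ℝ)))

/-- A real matrix viewed as a complex matrix. -/
def toComplex (M : Matrix σ ι ℝ) : Matrix σ ι ℂ := M.map (fun r : ℝ => (r : ℂ))

/-- Internal stability of the autonomous system `ẋ = M x`: the matrix `M` is stable, that is,
all of its complex eigenvalues have negative real part. -/
def InternallyStable (M : Matrix σ σ ℝ) : Prop :=
  ∀ z ∈ spectrum ℂ (toComplex M), z.re < 0

/-- `x` solves `ẋ = M x` on `[0, ∞)`. -/
def IsSolution (M : Matrix σ σ ℝ) (x : ℝ → σ → ℝ) : Prop :=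
  ∀ t : ℝ, 0 ≤ t → HasDerivWithinAt x (M *ᵥ x t) (Set.Ici 0) t

open scoped Matrix.Norms.L2Operator in
/-- The `H∞` norm of a transfer matrix: the supremum over the open right half-plane of its largest
singular value (the operator norm with respect to Euclidean norms). -/
def hInfNorm [DecidableEq κ] (G : ℂ → Matrix ι κ ℂ) : ℝ≥0∞ :=
  ⨆ s : {s : ℂ // 0 < s.re}, ‖G s‖ₑ

/-- The controlled linear system `ẋ = A x + B u`, with state index `σ` and input index `ι`. -/
structure LTISystem (σ ι : Type*) where
  /-- The state matrix. -/
  A : Matrix σ σ ℝ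
  /-- The input matrix. -/
  B : Matrix σ ι ℝ

/-- The state matrix of the closed loop of `ẋ = A x + B u` with `u = F x`. -/
def LTISystem.closedLoop (S : LTISystem σ ι) (F : Matrix ι σ ℝ) : Matrix σ σ ℝ :=
  S.A + S.B * F

/-- The cascade interconnection in which the signal `C x` of the upstream system, with state `x`,
is the input of the downstream system. -/
def LTISystem.cascade (up : LTISystem σ ι) (C : Matrix κ σ ℝ) (down : LTISystem τ κ) :
    LTISystem (σ ⊕ τ) ι where
  A := fromBlocks up.A 0 (down.B * C) down.A
  B := fromRows up.B 0

/-- The transfer matrix `C (sI - A)⁻¹ B` from `u` to `C x`. -/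
def LTISystem.transfer (S : LTISystem σ ι) (C : Matrix κ σ ℝ) (s : ℂ) : Matrix κ ι ℂ :=
  toComplex C * (s • (1 : Matrix σ σ ℂ) - toComplex S.A)⁻¹ * toComplex S.B

/-! ### The preexisting system and its parameterized hierarchical realization -/

variable {n₁ n₂ m₁ p₁ p₂ nh₁ : ℕ}

/-- The matrices of the interconnection of
`ẋ₁ = A₁ x₁ + L₁ γ₂ + B₁ u₁` and `ẋ₂ = A₂ x₂ + L₂ Γ₁ x₁`, `γ₂ = Γ₂ x₂`. -/
structure Preexisting (n₁ n₂ m₁ p₁ p₂ : ℕ) where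
  A₁ : Matrix (Fin n₁) (Fin n₁) ℝ
  L₁ : Matrix (Fin n₁) (Fin p₂) ℝ
  B₁ : Matrix (Fin n₁) (Fin m₁) ℝ
  A₂ : Matrix (Fin n₂) (Fin n₂) ℝ
  L₂ : Matrix (Fin n₂) (Fin p₁) ℝ
  Γ₁ : Matrix (Fin p₁) (Fin n₁) ℝ
  Γ₂ : Matrix (Fin p₂) (Fin n₂) ℝ

/-- The state matrix of the whole interconnected system. -/
def Preexisting.A (S : Preexisting n₁ n₂ m₁ p₁ p₂) :
    Matrix (Fin n₁ ⊕ Fin n₂) (Fin n₁ ⊕ Fin n₂) ℝ :=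
  fromBlocks S.A₁ (S.L₁ * S.Γ₂) (S.L₂ * S.Γ₁) S.A₂

/-- `E₁ = [I; 0]`. -/
def E₁ (n₁ n₂ : ℕ) : Matrix (Fin n₁ ⊕ Fin n₂) (Fin n₁) ℝ := fromRows 1 0

/-- `E₂ = [0; I]`. -/
def E₂ (n₁ n₂ : ℕ) : Matrix (Fin n₁ ⊕ Fin n₂) (Fin n₂) ℝ := fromRows 0 1

/-- A left invertible matrix `P` with a chosen left inverse `Pd`, and a complementary left
invertible matrix `Q` with left inverse `Qd`, such that `P Pd + Q Qd = I`. -/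
structure Projection (n₁ nh₁ : ℕ) where
  P : Matrix (Fin n₁) (Fin nh₁) ℝ
  Pd : Matrix (Fin nh₁) (Fin n₁) ℝ
  Q : Matrix (Fin n₁) (Fin (n₁ - nh₁)) ℝ
  Qd : Matrix (Fin (n₁ - nh₁)) (Fin n₁) ℝ
  Pd_mul_P : Pd * P = 1
  Qd_mul_Q : Qd * Q = 1
  sum_eq_one : P * Pd + Q * Qd = 1

namespace Preexisting

variable (S : Preexisting n₁ n₂ m₁ p₁ p₂) (R : Projection n₁ nh₁)

/-- The upstream dynamics `ξ̂₁' = P† A₁ P ξ̂₁ + P† B₁ u₁`. -/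
def upstream : LTISystem (Fin nh₁) (Fin m₁) where
  A := R.Pd * S.A₁ * R.P
  B := R.Pd * S.B₁

/-- The downstream dynamics `ξ' = A ξ + [Q Q† A₁; L₂ Γ₁] w`, whose input `w` is `P ξ̂₁`. -/
def downstream : LTISystem (Fin n₁ ⊕ Fin n₂) (Fin n₁) where
  A := S.A
  B := E₁ n₁ n₂ * (R.Q * R.Qd * S.A₁) + E₂ n₁ n₂ * (S.L₂ * S.Γ₁)

/-- The hierarchical realization, with state `(ξ̂₁, (ξ₁, ξ₂))` and input `u₁`. -/
def hierarchical : LTISystem (Fin nh₁ ⊕ (Fin n₁ ⊕ Fin n₂)) (Fin m₁) :=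
  (S.upstream R).cascade R.P (S.downstream R)

/-- The state matrix of the closed loop of the hierarchical realization with `u₁ = K ξ̂₁`. -/
def hierarchicalClosedLoop (K : Matrix (Fin m₁) (Fin nh₁) ℝ) :
    Matrix (Fin nh₁ ⊕ (Fin n₁ ⊕ Fin n₂)) (Fin nh₁ ⊕ (Fin n₁ ⊕ Fin n₂)) ℝ :=
  (S.hierarchical R).closedLoop (fromCols K 0)

/-- The initial value of `ξ₁`, namely `Q Q† δ₀ + P P† ζ₀`. -/
def _root_.Retrofit.Projection.init₁ (R : Projection n₁ nh₁) (δ₀ ζ₀ : Fin n₁ → ℝ) : Fin n₁ → ℝ :=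
  (R.Q * R.Qd) *ᵥ δ₀ + (R.P * R.Pd) *ᵥ ζ₀

/-- `(ξ̂₁, ξ₁, ξ₂)` solves the closed loop of the hierarchical realization with `u₁ = K ξ̂₁`,
with `ξ̂₁(0) = P† (δ₀ - ζ₀)`, `ξ₁(0) = Q Q† δ₀ + P P† ζ₀` and `ξ₂(0) = 0`. -/
structure IsResponse (K : Matrix (Fin m₁) (Fin nh₁) ℝ) (δ₀ ζ₀ : Fin n₁ → ℝ)
    (ξh : ℝ → Fin nh₁ → ℝ) (ξ₁ : ℝ → Fin n₁ → ℝ) (ξ₂ : ℝ → Fin n₂ → ℝ) : Prop where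
  solution : IsSolution (S.hierarchicalClosedLoop R K)
    (fun t => Sum.elim (ξh t) (Sum.elim (ξ₁ t) (ξ₂ t)))
  init_up : ξh 0 = R.Pd *ᵥ (δ₀ - ζ₀)
  init_one : ξ₁ 0 = R.init₁ δ₀ ζ₀
  init_two : ξ₂ 0 = 0

/-- The specification: every solution `ξ̂₁` of `ξ̂₁' = (P† A₁ P + P† B₁ K) ξ̂₁` starting in
`{P† δ₀ : ‖δ₀‖ ≤ 1}` satisfies `‖ξ̂₁‖_{L²} ≤ ε`. -/
def Specification (K : Matrix (Fin m₁) (Fin nh₁) ℝ) (ε : ℝ) : Prop :=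
  ∀ ξh : ℝ → Fin nh₁ → ℝ,
    IsSolution (R.Pd * S.A₁ * R.P + R.Pd * S.B₁ * K) ξh →
    (∃ δ₀ : Fin n₁ → ℝ, euclNorm δ₀ ≤ 1 ∧ ξh 0 = R.Pd *ᵥ δ₀) →
    l2Norm ξh ≤ ENNReal.ofReal ε

/-- The transfer matrix from `P ξ̂₁` to `ξ₁`. -/
def G₁ : ℂ → Matrix (Fin n₁) (Fin n₁) ℂ := (S.downstream R).transfer (E₁ n₁ n₂)ᵀ

/-- The transfer matrix from `P ξ̂₁` to `ξ₂`. -/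
def G₂ : ℂ → Matrix (Fin n₂) (Fin n₁) ℂ := (S.downstream R).transfer (E₂ n₁ n₂)ᵀ

/-- `‖(G₁ + I) P‖_{H∞}`. -/
def α₁ : ℝ≥0∞ := hInfNorm fun s => (S.G₁ R s + 1) * toComplex R.P

/-- `‖G₂ P‖_{H∞}`. -/
def α₂ : ℝ≥0∞ := hInfNorm fun s => S.G₂ R s * toComplex R.P

/-- `‖E₁ᵀ e^{At} E₁ (Q Q† δ₀ + P P† ζ₀)‖_{L²}`. -/
def β₁ (δ₀ ζ₀ : Fin n₁ → ℝ) : ℝ≥0∞ :=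
  l2Norm fun t => ((E₁ n₁ n₂)ᵀ * NormedSpace.exp (t • S.A) * E₁ n₁ n₂) *ᵥ R.init₁ δ₀ ζ₀

/-- `‖E₂ᵀ e^{At} E₁ (Q Q† δ₀ + P P† ζ₀)‖_{L²}`. -/
def β₂ (δ₀ ζ₀ : Fin n₁ → ℝ) : ℝ≥0∞ :=
  l2Norm fun t => ((E₂ n₁ n₂)ᵀ * NormedSpace.exp (t • S.A) * E₁ n₁ n₂) *ᵥ R.init₁ δ₀ ζ₀

end Preexisting

end

end Retrofit

/-! The feedback reads only the upstream state, so the closed-loop matrix is block lower triangular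
with diagonal blocks the matrix of (2) and `A`. Its characteristic polynomial factors, and since `A`
is stable, (a) follows.

For (b), the downstream state is driven by `ξ̂₁` through a stable system. By superposition
(`l2Norm_output_le_add`) each output is a free response, whose norm is `β`, plus a forced response
from zero state. The forced part is bounded by the `H∞` norm times the `L²` norm of `ξ̂₁`: Laplace
transforms satisfy `ŷ = G ŵ` pointwise on the open right half-plane, Plancherel on each line `Re s =
η` gives the bound for damped signals, and `η → 0` removes the damping (`eLpNorm_le_of_laplace_le`,
`eLpNorm_output_le`). Finiteness of `α` and `β` comes from bounded resolvents and exponential decay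
of stable matrices. The factor `1 + ‖ζ₀‖` is homogeneity: `δ₀ - ζ₀` lies in a ball of that radius.
-/

namespace Retrofit

open Matrix MeasureTheory
open scoped ENNReal

noncomputable section

/-! ### Plancherel for Fourier integrals of functions in `L¹ ∩ L²` -/

section Plancherel

open FourierTransform SchwartzMap

variable {F : Type*} [NormedAddCommGroup F] [InnerProductSpace ℂ F] [CompleteSpace F]

/-- The `L²` Fourier transform of an integrable square-integrable function is given by the
Fourier integral. -/
theorem fourier_toLp_ae_eq {f : ℝ → F} (h₁ : Integrable f) (h₂ : MemLp f 2) :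
    (𝓕 h₂.toLp : Lp (α := ℝ) F 2) =ᵐ[volume] 𝓕 f := by
  have hcont : Continuous (𝓕 f) :=
    VectorFourier.fourierIntegral_continuous Real.continuous_fourierChar
      continuous_inner h₁
  refine ae_eq_of_integral_contDiff_smul_eq
    ((Lp.memLp _).locallyIntegrable (by norm_num)) hcont.locallyIntegrable fun g hg hgc => ?_
  -- Tested against `φ`, the distributional Fourier transform of `f` is `∫ 𝓕 φ • f`; the symmetry of
  -- the Fourier integral turns this into `∫ φ • 𝓕 f`.
  let φ : 𝓢(ℝ, ℂ) := (hgc.comp_left Complex.ofReal_zero).toSchwartzMap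
    (Complex.ofRealCLM.contDiff.comp hg)
  have key := congrArg (fun T => T φ) (Lp.fourier_toTemperedDistribution_eq h₂.toLp)
  simp only [TemperedDistribution.fourier_apply, Lp.toTemperedDistribution_apply] at key
  have hflip : ∫ x, (𝓕 φ) x • f x = ∫ x, φ x • 𝓕 f x := by
    have := VectorFourier.integral_fourierIntegral_smul_eq_flip (μ := volume) (ν := volume)
      (L := innerₗ ℝ) Real.continuous_fourierChar continuous_inner φ.integrable h₁
    rw [flip_innerₗ] at this
    exact this
  have e₁ : ∫ x, (𝓕 φ) x • (h₂.toLp f) x = ∫ x, (𝓕 φ) x • f x :=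
    integral_congr_ae (by filter_upwards [h₂.coeFn_toLp] with x hx; rw [hx])
  exact key.symm.trans (e₁.trans hflip)

/-- **Plancherel's theorem** for the Fourier integral. -/
theorem eLpNorm_fourier_eq {f : ℝ → F} (h₁ : Integrable f) (h₂ : MemLp f 2) :
    eLpNorm (𝓕 f) 2 volume = eLpNorm f 2 volume := by
  rw [← eLpNorm_congr_ae (fourier_toLp_ae_eq h₁ h₂), ← eLpNorm_congr_ae h₂.coeFn_toLp,
    ← Lp.enorm_def, ← Lp.enorm_def, ← ofReal_norm, ← ofReal_norm, Lp.norm_fourier_eq]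

end Plancherel

/-! ### From Laplace transforms on the half-plane to `L²` norms -/

section Laplace

open FourierTransform Filter Topology

variable {F G : Type*} [NormedAddCommGroup F] [InnerProductSpace ℂ F]
  [NormedAddCommGroup G] [InnerProductSpace ℂ G]

/-- The Laplace transform on the time axis. -/
def laplace (f : ℝ → F) (s : ℂ) : F := ∫ t in Set.Ioi (0 : ℝ), Complex.exp (-s * t) • f t

/-- The exponentially weighted extension by zero of a signal. -/
def damp (η : ℝ) (f : ℝ → F) : ℝ → F :=
  (Set.Ioi (0 : ℝ)).indicator fun t => Real.exp (-η * t) • f t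

/-- The weight `e^{-ηt}` and the character `e^{-2πiωt}` combine into `e^{-st}`, so Plancherel
becomes a statement on the line `Re s = η`. -/
theorem fourier_damp (f : ℝ → F) (η ω : ℝ) :
    𝓕 (damp η f) ω = laplace f (η + 2 * Real.pi * ω * Complex.I) := by
  rw [Real.fourier_real_eq_integral_exp_smul, laplace, ← integral_indicator measurableSet_Ioi]
  congr 1 with t
  by_cases ht : t ∈ Set.Ioi (0 : ℝ)
  · simp only [damp, Set.indicator_of_mem ht]
    rw [← Complex.coe_smul (Real.exp _), smul_smul, Complex.ofReal_exp, ← Complex.exp_add]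
    congr 2
    push_cast
    ring
  · simp [damp, Set.indicator_of_notMem ht]

theorem eLpNorm_damp_le {η : ℝ} (hη : 0 ≤ η) (f : ℝ → F) :
    eLpNorm (damp η f) 2 volume ≤ eLpNorm f 2 (volume.restrict (Set.Ioi 0)) := by
  rw [damp, eLpNorm_indicator_eq_eLpNorm_restrict measurableSet_Ioi]
  refine eLpNorm_mono_ae ?_
  filter_upwards [ae_restrict_mem measurableSet_Ioi] with t ht
  rw [norm_smul, Real.norm_eq_abs, Real.abs_exp]
  refine mul_le_of_le_one_left (norm_nonneg _) (Real.exp_le_one_iff.2 ?_)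
  have : 0 ≤ η * t := mul_nonneg hη (le_of_lt ht)
  linarith

/-- Fatou's lemma along `η = 1/(n+1)`, since the weights tend to `1` pointwise. -/
theorem eLpNorm_le_of_forall_damp {f : ℝ → F} {c : ℝ≥0∞}
    (hf : AEStronglyMeasurable f (volume.restrict (Set.Ioi 0)))
    (h : ∀ η : ℝ, 0 < η → eLpNorm (damp η f) 2 volume ≤ c) :
    eLpNorm f 2 (volume.restrict (Set.Ioi 0)) ≤ c := by
  let η : ℕ → ℝ := fun n => 1 / ((n : ℝ) + 1)
  have hη : ∀ n, 0 < η n := fun n => by positivity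
  have hlim : Tendsto η atTop (𝓝 0) := tendsto_one_div_add_atTop_nhds_zero_nat
  have := Lp.eLpNorm_lim_le_liminf_eLpNorm (p := 2) (μ := volume.restrict (Set.Ioi (0 : ℝ)))
    (f := fun n t => Real.exp (-η n * t) • f t)
    (fun n => (Continuous.aestronglyMeasurable (f := fun t => Real.exp (-η n * t))
      (by fun_prop)).smul hf) f
    (Eventually.of_forall fun t => by
      have h1 : Tendsto (fun n => Real.exp (-η n * t)) atTop (𝓝 (Real.exp (-0 * t))) :=
        (Real.continuous_exp.tendsto _).comp ((hlim.neg).mul_const t)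
      simpa using h1.smul_const (f t))
  refine this.trans (liminf_le_of_le (by isBoundedDefault) fun b hb => ?_)
  obtain ⟨n, hn⟩ := hb.exists
  refine hn.trans ?_
  rw [← eLpNorm_indicator_eq_eLpNorm_restrict measurableSet_Ioi]
  exact h _ (hη n)

/-- A pointwise bound between Laplace transforms on the open right half-plane yields a bound
between `L²` norms. -/
theorem eLpNorm_le_of_laplace_le [CompleteSpace F] [CompleteSpace G] {y : ℝ → G} {w : ℝ → F} {γ : NNReal}
    (hy : AEStronglyMeasurable y (volume.restrict (Set.Ioi 0)))
    (hy₁ : ∀ η : ℝ, 0 < η → Integrable (damp η y))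
    (hy₂ : ∀ η : ℝ, 0 < η → MemLp (damp η y) 2)
    (hw₁ : ∀ η : ℝ, 0 < η → Integrable (damp η w))
    (hw₂ : ∀ η : ℝ, 0 < η → MemLp (damp η w) 2)
    (h : ∀ s : ℂ, 0 < s.re → ‖laplace y s‖ ≤ γ * ‖laplace w s‖) :
    eLpNorm y 2 (volume.restrict (Set.Ioi 0)) ≤
      γ * eLpNorm w 2 (volume.restrict (Set.Ioi 0)) := by
  refine eLpNorm_le_of_forall_damp hy fun η hη => ?_
  calc eLpNorm (damp η y) 2 volume = eLpNorm (𝓕 (damp η y)) 2 volume :=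
        (eLpNorm_fourier_eq (hy₁ η hη) (hy₂ η hη)).symm
    _ ≤ γ • eLpNorm (𝓕 (damp η w)) 2 volume := by
        refine eLpNorm_le_nnreal_smul_eLpNorm_of_ae_le_mul (Eventually.of_forall fun ω => ?_) 2
        rw [fourier_damp, fourier_damp]
        exact h _ (by simpa using hη)
    _ = γ * eLpNorm (damp η w) 2 volume := by
        rw [eLpNorm_fourier_eq (hw₁ η hη) (hw₂ η hη)]; rfl
    _ ≤ _ := by gcongr; exact eLpNorm_damp_le hη.le w

end Laplace

/-! ### Exponential decay and bounded resolvent of a stable matrix -/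

section MatrixExponential

open NormedSpace Filter Topology
open scoped Matrix.Norms.L2Operator

variable {σ : Type*} [Fintype σ] [DecidableEq σ]

theorem exp_mulVec_of_mulVec_eq_smul {a : Matrix σ σ ℂ} {v : σ → ℂ} {w : ℂ}
    (h : a *ᵥ v = w • v) : exp a *ᵥ v = Complex.exp w • v := by
  have hpow : ∀ n : ℕ, a ^ n *ᵥ v = w ^ n • v := by
    intro n
    induction n with
    | zero => simp
    | succ n ih => rw [pow_succ, ← mulVec_mulVec, h, mulVec_smul, ih, smul_smul, pow_succ']
  have h₁ : HasSum (fun n : ℕ => ((n.factorial⁻¹ : ℂ) • a ^ n) *ᵥ v) (exp a *ᵥ v) :=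
    (exp_series_hasSum_exp' (𝕂 := ℂ) a).map ((mulVecBilin ℂ ℂ).flip v)
      (Continuous.matrix_mulVec continuous_id continuous_const)
  have h₂ : HasSum (fun n : ℕ => ((n.factorial⁻¹ : ℂ) • w ^ n) • v) (exp w • v) :=
    (exp_series_hasSum_exp' (𝕂 := ℂ) w).smul_const v
  rw [Complex.exp_eq_exp_ℂ]
  refine h₁.unique ?_
  convert h₂ using 2 with n
  rw [smul_mulVec, hpow, smul_assoc]

/-- Since `a` commutes with `exp a`, it preserves the `z`-eigenspace of `exp a` and so has an
eigenvector there; its eigenvalue `w` must satisfy `e^w = z`. -/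
theorem exists_mem_spectrum_of_mem_spectrum_exp {a : Matrix σ σ ℂ} {z : ℂ}
    (hz : z ∈ spectrum ℂ (exp a)) : ∃ w ∈ spectrum ℂ a, Complex.exp w = z := by
  rw [← spectrum_toLin', ← Module.End.hasEigenvalue_iff_mem_spectrum] at hz
  have hcomm : Commute (toLin' (exp a)) (toLin' a) := by
    have : Commute (exp a) a := (Commute.refl a).exp_left
    exact this.map (toLinAlgEquiv' (R := ℂ) (n := σ))
  have hmaps := Module.End.mapsTo_genEigenspace_of_comm hcomm z 1
  have : Nontrivial (Module.End.genEigenspace (toLin' (exp a)) z 1) :=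
    Submodule.nontrivial_iff_ne_bot.2 hz
  obtain ⟨w, hw⟩ := Module.End.exists_eigenvalue ((toLin' a).restrict hmaps)
  obtain ⟨⟨v, hv⟩, hvw, hv0⟩ := hw.exists_hasEigenvector
  have hv0' : v ≠ 0 := fun h => hv0 (by simpa using h)
  rw [Module.End.mem_eigenspace_iff] at hvw
  have hav : a *ᵥ v = w • v := congrArg Subtype.val hvw
  have hev : exp a *ᵥ v = z • v := by simpa using Module.End.mem_eigenspace_iff.1 hv
  refine ⟨w, ?_, ?_⟩
  · rw [← spectrum_toLin', ← Module.End.hasEigenvalue_iff_mem_spectrum]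
    exact Module.End.hasEigenvalue_of_hasEigenvector (x := v)
      ⟨Module.End.mem_eigenspace_iff.2 (by simpa using hav), hv0'⟩
  · rw [exp_mulVec_of_mulVec_eq_smul hav] at hev
    exact smul_left_injective ℂ hv0' hev

theorem spectralRadius_exp_lt_one {a : Matrix σ σ ℂ} (ha : ∀ z ∈ spectrum ℂ a, z.re < 0) :
    spectralRadius ℂ (exp a) < 1 := by
  rcases (spectrum ℂ (exp a)).eq_empty_or_nonempty with h | h
  · simp [spectralRadius, h]
  · refine mod_cast spectrum.spectralRadius_lt_of_forall_lt_of_nonempty h (r := 1) fun z hz => ?_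
    obtain ⟨w, hw, rfl⟩ := exists_mem_spectrum_of_mem_spectrum_exp hz
    rw [← NNReal.coe_lt_coe, coe_nnnorm, Complex.norm_exp]
    exact Real.exp_lt_one_iff.2 (ha w hw)

/-- The exponential of a stable matrix decays exponentially. -/
theorem exists_norm_exp_smul_le {a : Matrix σ σ ℂ} (ha : ∀ z ∈ spectrum ℂ a, z.re < 0) :
    ∃ C c : ℝ, 0 < C ∧ 0 < c ∧ ∀ t : ℝ, 0 ≤ t → ‖exp (t • a)‖ ≤ C * Real.exp (-c * t) := by
  -- Gelfand's formula with `r` strictly between the spectral radius and `1` gives geometric decay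
  -- of the powers from some `N` on; compactness handles `[0, N + 1]`.
  obtain ⟨r, hr₁, hr₂⟩ := ENNReal.lt_iff_exists_nnreal_btwn.1 (spectralRadius_exp_lt_one ha)
  have hr₂' : r < 1 := mod_cast hr₂
  have hr0 : 0 < r := by
    have := (zero_le (a := spectralRadius ℂ (exp a))).trans_lt hr₁
    exact_mod_cast this
  have hev : ∀ᶠ n : ℕ in atTop, ‖exp a ^ n‖ ≤ (r : ℝ) ^ n := by
    filter_upwards [(spectrum.pow_nnnorm_pow_one_div_tendsto_nhds_spectralRadius
      (exp a)).eventually_lt_const hr₁, eventually_gt_atTop 0] with n hn hn0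
    have hn0' : (n : ℝ) ≠ 0 := by positivity
    have h := ENNReal.rpow_le_rpow hn.le (z := n) (by positivity)
    rw [← ENNReal.rpow_mul, one_div, inv_mul_cancel₀ hn0', ENNReal.rpow_one,
      ENNReal.rpow_natCast] at h
    exact_mod_cast h
  obtain ⟨N, hN⟩ := eventually_atTop.1 hev
  have hcont : Continuous fun t : ℝ => ‖exp (t • a)‖ := by
    have : Continuous fun t : ℝ => exp (t • a) :=
      (differentiable_exp_smul_const ℝ a).continuous
    exact this.norm
  obtain ⟨D, hD⟩ := (isCompact_Icc (a := (0 : ℝ)) (b := N + 1)).exists_bound_of_continuousOn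
    hcont.continuousOn
  simp only [norm_norm] at hD
  set c : ℝ := -Real.log r with hc
  have hc0 : 0 < c := by
    have := Real.log_neg (x := r) (by exact_mod_cast hr0) (by exact_mod_cast hr₂')
    linarith
  have hrc : (r : ℝ) = Real.exp (-c) := by
    rw [hc, neg_neg, Real.exp_log (by exact_mod_cast hr0)]
  have hD0 : 0 ≤ D := (norm_nonneg _).trans (hD 0 ⟨le_rfl, by positivity⟩)
  -- The factor `e^{c(N+1)}` makes the bound at least `D + 1` up to time `N + 1`; later it absorbs
  -- the loss, less than `e^c`, from replacing `t` by its integer part. The `+ 1` keeps the constant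
  -- positive.
  refine ⟨(D + 1) * Real.exp (c * (N + 1)), c, by positivity, hc0, fun t ht => ?_⟩
  rw [mul_assoc, ← Real.exp_add]
  rcases le_or_gt t (N + 1) with htN | htN
  · calc ‖exp (t • a)‖ ≤ (D + 1) * 1 := by linarith [hD t ⟨ht, htN⟩]
      _ ≤ _ := by
        gcongr
        exact Real.one_le_exp (by nlinarith)
  · set n := ⌊t⌋₊ with hn
    have hnt : (n : ℝ) ≤ t := Nat.floor_le ht
    have htn : t < n + 1 := Nat.lt_floor_add_one t
    have hNn : N ≤ n := by
      have : (N : ℝ) < n + 1 := by linarith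
      have : N < n + 1 := by exact_mod_cast this
      omega
    have hsplit : exp (t • a) = exp a ^ n * exp ((t - n) • a) := by
      rw [← Matrix.exp_nsmul, ← Matrix.exp_add_of_commute]
      · congr 1
        rw [← Nat.cast_smul_eq_nsmul ℝ, ← add_smul]
        congr 1; ring
      · exact ((Commute.refl a).smul_left _).smul_right _
    calc ‖exp (t • a)‖ ≤ ‖exp a ^ n‖ * ‖exp ((t - n) • a)‖ := by
          rw [hsplit]; exact norm_mul_le _ _
      _ ≤ (r : ℝ) ^ n * D := by
          gcongr
          · exact hN n hNn
          · exact hD _ ⟨by linarith, by linarith [Nat.cast_nonneg (α := ℝ) N]⟩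
      _ = D * Real.exp (-c * n) := by
          rw [hrc, ← Real.exp_nat_mul]; ring_nf
      _ ≤ (D + 1) * Real.exp (c * (N + 1) + -c * t) := by
          gcongr
          · linarith
          · nlinarith [Nat.cast_nonneg (α := ℝ) N]

/-- The resolvent of a stable matrix is bounded on the open right half-plane. -/
theorem exists_norm_resolvent_le {a : Matrix σ σ ℂ} (ha : ∀ z ∈ spectrum ℂ a, z.re < 0) :
    ∃ C : ℝ, ∀ s : ℂ, 0 < s.re → ‖(s • (1 : Matrix σ σ ℂ) - a)⁻¹‖ ≤ C := by
  have hres : ∀ s : ℂ, (s • (1 : Matrix σ σ ℂ) - a)⁻¹ = resolvent a s := fun s => by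
    rw [nonsing_inv_eq_ringInverse, resolvent, Algebra.algebraMap_eq_smul_one]
  -- The resolvent vanishes at infinity, and the rest of the closed half-plane is a compact set
  -- missing the spectrum.
  have hfar : ∀ᶠ z in Bornology.cobounded ℂ, ‖resolvent a z‖ < 1 := by
    have := (spectrum.resolvent_tendsto_cobounded (𝕜 := ℂ) a).norm
    rw [norm_zero] at this
    exact this.eventually_lt_const one_pos
  obtain ⟨r, -, hr⟩ := (atTop_basis_Ioi.cobounded_of_norm.eventually_iff).1 hfar
  have hcpt : IsCompact (Metric.closedBall (0 : ℂ) r ∩ {z | 0 ≤ z.re}) :=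
    (isCompact_closedBall _ _).inter_right (isClosed_le continuous_const Complex.continuous_re)
  obtain ⟨D, hD⟩ := hcpt.exists_bound_of_continuousOn (f := resolvent a) fun z hz => by
    have : z ∈ resolventSet ℂ a := by
      by_contra h
      exact absurd (ha z h) (not_lt.2 hz.2)
    exact (spectrum.hasDerivAt_resolvent_const_left this).continuousAt.continuousWithinAt
  refine ⟨max D 1, fun s hs => ?_⟩
  rw [hres]
  by_cases h : ‖s‖ ≤ r
  · exact (hD s ⟨by simpa using h, hs.le⟩).trans (le_max_left _ _)
  · exact (hr (by simpa using h)).le.trans (le_max_right _ _)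

end MatrixExponential

/-! ### Signals with a Laplace transform on the open right half-plane -/

section Signals

open Filter Topology

variable {F G : Type*} [NormedAddCommGroup F] [InnerProductSpace ℂ F]
  [NormedAddCommGroup G] [InnerProductSpace ℂ G]

/-- A signal on `(0, ∞)` that becomes integrable and square-integrable after multiplication by any
decaying exponential. -/
structure IsSubexponential (f : ℝ → F) : Prop where
  aestronglyMeasurable : AEStronglyMeasurable f (volume.restrict (Set.Ioi 0))
  integrable : ∀ η : ℝ, 0 < η →
    Integrable (fun t => Real.exp (-η * t) • f t) (volume.restrict (Set.Ioi 0))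
  memLp : ∀ η : ℝ, 0 < η →
    MemLp (fun t => Real.exp (-η * t) • f t) 2 (volume.restrict (Set.Ioi 0))

theorem memLp_exp_neg {η : ℝ} (hη : 0 < η) :
    MemLp (fun t : ℝ => Real.exp (-η * t)) 2 (volume.restrict (Set.Ioi 0)) := by
  rw [memLp_two_iff_integrable_sq (Continuous.aestronglyMeasurable (by fun_prop))]
  refine (integrableOn_exp_mul_Ioi (a := -(2 * η)) (by linarith) 0).congr
    (Eventually.of_forall fun t => ?_)
  simp only [← Real.exp_nat_mul]
  congr 1
  push_cast
  ring

namespace IsSubexponential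

theorem of_memLp {f : ℝ → F} (hf : MemLp f 2 (volume.restrict (Set.Ioi 0))) :
    IsSubexponential f where
  aestronglyMeasurable := hf.1
  integrable η hη := by
    rw [← memLp_one_iff_integrable]
    have h : MemLp ((fun t : ℝ => Real.exp (-η * t)) • f) 1 (volume.restrict (Set.Ioi 0)) :=
      MemLp.smul (p := 2) (q := 2) hf (memLp_exp_neg hη)
    exact h
  memLp η hη := by
    refine hf.mono ((Continuous.aestronglyMeasurable (f := fun t : ℝ => Real.exp (-η * t))
      (by fun_prop)).smul hf.1) ?_
    filter_upwards [ae_restrict_mem measurableSet_Ioi] with t ht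
    rw [norm_smul, Real.norm_eq_abs, Real.abs_exp]
    refine mul_le_of_le_one_left (norm_nonneg _) (Real.exp_le_one_iff.2 ?_)
    have : 0 ≤ η * t := mul_nonneg hη.le (le_of_lt ht)
    linarith

/-- Half of the decay rate is spent on absorbing the linear factor, through `x + 1 ≤ e^x` at `x =
ηt/2`. -/
theorem exp_mul_one_add_le {η t : ℝ} (hη : 0 < η) (ht : 0 ≤ t) :
    Real.exp (-η * t) * (1 + t) ≤ (1 + 2 / η) * Real.exp (-(η / 2) * t) := by
  have h₁ : 1 + t ≤ (1 + 2 / η) * Real.exp (η / 2 * t) := by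
    have h₂ := Real.add_one_le_exp (η / 2 * t)
    have h₃ : 0 ≤ η / 2 * t := by positivity
    have h₄ : t = 2 / η * (η / 2 * t) := by field_simp
    have h₅ : 0 ≤ 2 / η := by positivity
    calc 1 + t = 1 + 2 / η * (η / 2 * t) := by rw [← h₄]
      _ ≤ (1 + 2 / η) * (η / 2 * t + 1) := by nlinarith
      _ ≤ _ := by gcongr
  calc Real.exp (-η * t) * (1 + t)
      ≤ Real.exp (-η * t) * ((1 + 2 / η) * Real.exp (η / 2 * t)) := by gcongr
    _ = (1 + 2 / η) * Real.exp (-η * t + η / 2 * t) := by rw [Real.exp_add]; ring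
    _ = _ := by congr 2; ring

theorem of_linear_growth {f : ℝ → F} (hf : ContinuousOn f (Set.Ici 0)) {K : ℝ}
    (hK : ∀ t, 0 ≤ t → ‖f t‖ ≤ K * (1 + t)) : IsSubexponential f := by
  have hK0 : 0 ≤ K := by simpa using (norm_nonneg _).trans (hK 0 le_rfl)
  have hm : AEStronglyMeasurable f (volume.restrict (Set.Ioi 0)) :=
    (hf.mono Set.Ioi_subset_Ici_self).aestronglyMeasurable measurableSet_Ioi
  have hme : ∀ η : ℝ, AEStronglyMeasurable (fun t => Real.exp (-η * t) • f t)
      (volume.restrict (Set.Ioi 0)) := fun η =>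
    (Continuous.aestronglyMeasurable (f := fun t : ℝ => Real.exp (-η * t)) (by fun_prop)).smul hm
  have hb : ∀ η : ℝ, 0 < η → ∀ᵐ t ∂(volume.restrict (Set.Ioi (0 : ℝ))),
      ‖Real.exp (-η * t) • f t‖ ≤ ‖K * (1 + 2 / η) * Real.exp (-(η / 2) * t)‖ := by
    intro η hη
    filter_upwards [ae_restrict_mem measurableSet_Ioi] with t ht
    have ht' : 0 ≤ t := le_of_lt ht
    rw [norm_smul, Real.norm_eq_abs, Real.abs_exp, Real.norm_of_nonneg (by positivity)]
    calc Real.exp (-η * t) * ‖f t‖ ≤ Real.exp (-η * t) * (K * (1 + t)) := by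
          gcongr; exact hK t ht'
      _ = K * (Real.exp (-η * t) * (1 + t)) := by ring
      _ ≤ K * ((1 + 2 / η) * Real.exp (-(η / 2) * t)) := by
          exact mul_le_mul_of_nonneg_left (exp_mul_one_add_le hη ht') hK0
      _ = _ := by ring
  refine ⟨hm, fun η hη => ?_, fun η hη => ?_⟩
  · exact ((integrableOn_exp_mul_Ioi (a := -(η / 2)) (by linarith) 0).const_mul _).mono
      (hme η) (hb η hη)
  · exact ((memLp_exp_neg (half_pos hη)).const_mul _).mono (hme η) (hb η hη)

theorem add {f g : ℝ → F} (hf : IsSubexponential f) (hg : IsSubexponential g) :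
    IsSubexponential (fun t => f t + g t) where
  aestronglyMeasurable := hf.1.add hg.1
  integrable η hη := by
    simpa only [smul_add] using (hf.2 η hη).fun_add (hg.2 η hη)
  memLp η hη := by
    have := (hf.3 η hη).add (hg.3 η hη)
    simpa only [Pi.add_def, smul_add] using this

theorem clm_comp (T : F →L[ℂ] G) {f : ℝ → F} (hf : IsSubexponential f) :
    IsSubexponential (fun t => T (f t)) where
  aestronglyMeasurable := T.continuous.comp_aestronglyMeasurable hf.1
  integrable η hη := by
    simpa only [T.map_smul_of_tower] using T.integrable_comp (hf.2 η hη)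
  memLp η hη := by
    simpa only [Function.comp_def, T.map_smul_of_tower] using T.comp_memLp' (hf.3 η hη)

theorem integrable_damp {f : ℝ → F} (hf : IsSubexponential f) {η : ℝ} (hη : 0 < η) :
    Integrable (damp η f) :=
  (integrable_indicator_iff measurableSet_Ioi).2 (hf.2 η hη)

theorem memLp_damp {f : ℝ → F} (hf : IsSubexponential f) {η : ℝ} (hη : 0 < η) :
    MemLp (damp η f) 2 :=
  (memLp_indicator_iff_restrict measurableSet_Ioi).2 (hf.3 η hη)

theorem integrable_cexp_smul {f : ℝ → F} (hf : IsSubexponential f) {s : ℂ} (hs : 0 < s.re) :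
    Integrable (fun t : ℝ => Complex.exp (-s * t) • f t) (volume.restrict (Set.Ioi 0)) := by
  refine (hf.2 _ hs).mono ((Continuous.aestronglyMeasurable
    (f := fun t : ℝ => Complex.exp (-s * t)) (by fun_prop)).smul hf.1)
    (Eventually.of_forall fun t => le_of_eq ?_)
  rw [norm_smul, norm_smul, Complex.norm_exp, Real.norm_eq_abs, Real.abs_exp]
  simp

theorem laplace_add {f g : ℝ → F} (hf : IsSubexponential f) (hg : IsSubexponential g) {s : ℂ}
    (hs : 0 < s.re) : laplace (fun t => f t + g t) s = laplace f s + laplace g s := by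
  simp only [laplace, smul_add]
  exact integral_add (hf.integrable_cexp_smul hs) (hg.integrable_cexp_smul hs)

theorem laplace_clm [CompleteSpace F] [CompleteSpace G] (T : F →L[ℂ] G) {f : ℝ → F}
    (hf : IsSubexponential f) {s : ℂ} (hs : 0 < s.re) :
    laplace (fun t => T (f t)) s = T (laplace f s) := by
  simp only [laplace, ← map_smul]
  exact T.integral_comp_comm (hf.integrable_cexp_smul hs)

end IsSubexponential

/-- The Laplace transform of the derivative of a signal of linear growth vanishing at `0`. -/
theorem laplace_deriv [CompleteSpace F] {z z' : ℝ → F} {K : ℝ}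
    (hz : ∀ t, 0 ≤ t → HasDerivWithinAt z (z' t) (Set.Ici 0) t) (hz0 : z 0 = 0)
    (hK : ∀ t, 0 ≤ t → ‖z t‖ ≤ K * (1 + t)) (hz' : IsSubexponential z')
    {s : ℂ} (hs : 0 < s.re) : laplace z' s = s • laplace z s := by
  have hcont : ContinuousOn z (Set.Ici 0) := fun t ht => (hz t ht).continuousWithinAt
  have hsub : IsSubexponential z := .of_linear_growth hcont hK
  have hexp : ∀ t : ℝ, HasDerivAt (fun t : ℝ => Complex.exp (-s * t))
      (-s * Complex.exp (-s * t)) t := fun t => by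
    have h := ((hasDerivAt_id (t : ℂ)).const_mul (-s)).cexp.comp_ofReal
    simpa [mul_comm] using h
  have hderiv : ∀ t ∈ Set.Ioi (0 : ℝ), HasDerivAt (fun t : ℝ => Complex.exp (-s * t) • z t)
      (Complex.exp (-s * t) • z' t + (-s * Complex.exp (-s * t)) • z t) t := fun t ht =>
    (hexp t).fun_smul ((hz t (le_of_lt ht)).hasDerivAt (Ici_mem_nhds ht))
  have hint₂ : Integrable (fun t : ℝ => (-s * Complex.exp (-s * t)) • z t)
      (volume.restrict (Set.Ioi 0)) := by
    simpa only [mul_smul] using (hsub.integrable_cexp_smul hs).fun_smul (-s)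
  have hlim : Tendsto (fun t : ℝ => Complex.exp (-s * t) • z t) atTop (𝓝 0) := by
    have hdecay : Tendsto (fun t : ℝ => K * ((1 + 2 / s.re) * Real.exp (-(s.re / 2) * t)))
        atTop (𝓝 0) := by
      have h : Tendsto (fun t : ℝ => Real.exp (-(s.re / 2) * t)) atTop (𝓝 0) :=
        Real.tendsto_exp_atBot.comp
          (tendsto_id.const_mul_atTop_of_neg (by linarith))
      simpa using (h.const_mul (1 + 2 / s.re)).const_mul K
    have hK0 : 0 ≤ K := by simpa using (norm_nonneg _).trans (hK 0 le_rfl)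
    refine squeeze_zero_norm' ?_ hdecay
    filter_upwards [eventually_ge_atTop 0] with t ht
    rw [norm_smul, Complex.norm_exp]
    have hre : (-s * (t : ℂ)).re = -s.re * t := by simp
    rw [hre]
    calc Real.exp (-s.re * t) * ‖z t‖ ≤ Real.exp (-s.re * t) * (K * (1 + t)) := by
          gcongr; exact hK t ht
      _ = K * (Real.exp (-s.re * t) * (1 + t)) := by ring
      _ ≤ _ := by exact mul_le_mul_of_nonneg_left (IsSubexponential.exp_mul_one_add_le hs ht) hK0
  have hstart : ContinuousWithinAt (fun t : ℝ => Complex.exp (-s * t) • z t) (Set.Ici 0) 0 :=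
    (hexp 0).continuousAt.continuousWithinAt.smul (hcont 0 Set.self_mem_Ici)
  -- Integration by parts: the derivative of `e^{-st} z` integrates to zero, as both boundary terms
  -- vanish.
  have h := integral_Ioi_of_hasDerivAt_of_tendsto hstart hderiv
    ((hz'.integrable_cexp_smul hs).add hint₂) hlim
  rw [integral_add (hz'.integrable_cexp_smul hs) hint₂, hz0, smul_zero, sub_zero] at h
  simp only [mul_smul, integral_smul] at h
  rw [neg_smul, ← sub_eq_add_neg, sub_eq_zero] at h
  exact h

end Signals

/-! ### The `L²` gain of a complex stable system -/

section LinearSystems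

open Filter Topology
open scoped Matrix.Norms.L2Operator

variable {σ ι κ : Type*} [Fintype σ] [Fintype ι] [Fintype κ] [DecidableEq σ] [DecidableEq ι]

/-- A complex matrix as a continuous linear map between Euclidean spaces, linearly in the
matrix. -/
def act : Matrix κ ι ℂ →L[ℂ] EuclideanSpace ℂ ι →L[ℂ] EuclideanSpace ℂ κ :=
  LinearMap.toContinuousLinearMap
    (toEuclideanLin ≪≫ₗ LinearMap.toContinuousLinearMap).toLinearMap

theorem act_apply (M : Matrix κ ι ℂ) (v : EuclideanSpace ℂ ι) :
    act M v = WithLp.toLp 2 (M *ᵥ v.ofLp) := rfl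

theorem norm_act (M : Matrix κ ι ℂ) : ‖act M‖ = ‖M‖ := (l2_opNorm_def M).symm

theorem norm_act_apply_le (M : Matrix κ ι ℂ) (v : EuclideanSpace ℂ ι) :
    ‖act M v‖ ≤ ‖M‖ * ‖v‖ := (norm_act M) ▸ (act M).le_opNorm v

theorem act_mul (M : Matrix κ σ ℂ) (N : Matrix σ ι ℂ) (v : EuclideanSpace ℂ ι) :
    act (M * N) v = act M (act N v) := by
  simp [act_apply, mulVec_mulVec]

theorem act_one (v : EuclideanSpace ℂ ι) : act (1 : Matrix ι ι ℂ) v = v := by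
  simp [act_apply]

/-- The state of a stable system with zero initial state and continuous square-integrable input
grows at most linearly. -/
theorem exists_linear_growth {a : Matrix σ σ ℂ} (ha : ∀ z ∈ spectrum ℂ a, z.re < 0)
    (b : Matrix σ ι ℂ) {z : ℝ → EuclideanSpace ℂ σ} {w : ℝ → EuclideanSpace ℂ ι}
    (hw : ContinuousOn w (Set.Ici 0)) (hw₂ : MemLp w 2 (volume.restrict (Set.Ioi 0)))
    (hz : ∀ t, 0 ≤ t → HasDerivWithinAt z (act a (z t) + act b (w t)) (Set.Ici 0) t)
    (hz0 : z 0 = 0) : ∃ K : ℝ, ∀ t, 0 ≤ t → ‖z t‖ ≤ K * (1 + t) := by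
  obtain ⟨C, c, hC, hc, hexp⟩ := exists_norm_exp_smul_le ha
  have hCb : ∀ t : ℝ, 0 ≤ t → ‖NormedSpace.exp (t • a)‖ ≤ C := fun t ht =>
    (hexp t ht).trans (mul_le_of_le_one_right hC.le (Real.exp_le_one_iff.2 (by nlinarith)))
  have hsq : IntegrableOn (fun t => ‖w t‖ ^ 2) (Set.Ioi 0) := hw₂.norm.integrable_sq
  set I := ∫ t in Set.Ioi (0 : ℝ), ‖w t‖ ^ 2 with hI
  have hI0 : 0 ≤ I := integral_nonneg fun t => by positivity
  refine ⟨C * ‖b‖ * (1 + I), fun T hT => ?_⟩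
  -- Variation of constants: `exp((T - t)a) z(t)` has derivative `exp((T - t)a) b w(t)`, is `0` at
  -- `t = 0` and `z(T)` at `t = T`. Time is real, hence the restriction of scalars.
  let actR : Matrix σ σ ℂ →L[ℝ] EuclideanSpace ℂ σ →L[ℝ] EuclideanSpace ℂ σ :=
    (ContinuousLinearMap.restrictScalarsL ℂ _ _ ℝ ℝ).comp (act.restrictScalars ℝ)
  have hE : ∀ t : ℝ, HasDerivAt (fun t : ℝ => actR (NormedSpace.exp ((T - t) • a)))
      (actR (-(NormedSpace.exp ((T - t) • a) * a))) t := fun t => by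
    have h₁ : HasDerivAt (fun t : ℝ => NormedSpace.exp ((T - t) • a))
        ((-1 : ℝ) • (NormedSpace.exp ((T - t) • a) * a)) t :=
      (hasDerivAt_exp_smul_const a (T - t)).scomp t ((hasDerivAt_id t).const_sub T)
    rw [neg_one_smul] at h₁
    exact actR.hasFDerivAt.comp_hasDerivAt t h₁
  have hcontE : Continuous fun t : ℝ => actR (NormedSpace.exp ((T - t) • a)) :=
    continuous_iff_continuousAt.2 fun t => (hE t).continuousAt
  have hcontz : ContinuousOn z (Set.Ici 0) := fun t ht => (hz t ht).continuousWithinAt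
  have hsubset : Set.Icc 0 T ⊆ Set.Ici 0 := Set.Icc_subset_Ici_self
  have hcontf : ContinuousOn (fun t => act (NormedSpace.exp ((T - t) • a)) (act b (w t)))
      (Set.Icc 0 T) :=
    hcontE.continuousOn.clm_apply ((act b).continuous.comp_continuousOn (hw.mono hsubset))
  have hFTC := intervalIntegral.integral_eq_sub_of_hasDerivAt_of_le hT
    (f := fun t => act (NormedSpace.exp ((T - t) • a)) (z t))
    (f' := fun t => act (NormedSpace.exp ((T - t) • a)) (act b (w t)))
    (hcontE.continuousOn.clm_apply (hcontz.mono hsubset))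
    (fun t ht => by
      have hzt : HasDerivAt z (act a (z t) + act b (w t)) t :=
        (hz t ht.1.le).hasDerivAt (Ici_mem_nhds ht.1)
      have h := (hE t).clm_apply hzt
      refine h.congr_deriv ?_
      change act (-(NormedSpace.exp ((T - t) • a) * a)) (z t) +
          act (NormedSpace.exp ((T - t) • a)) (act a (z t) + act b (w t)) =
        act (NormedSpace.exp ((T - t) • a)) (act b (w t))
      simp [act_mul])
    (hcontf.intervalIntegrable_of_Icc hT)
  simp only [sub_self, zero_smul, NormedSpace.exp_zero, act_one, hz0, map_zero, sub_zero] at hFTC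
  have hint : IntervalIntegrable (fun t => 1 + ‖w t‖ ^ 2) volume 0 T :=
    ((hw.mono hsubset).norm.pow 2).const_add 1 |>.intervalIntegrable_of_Icc hT
  have hsqle : ∫ t in (0 : ℝ)..T, ‖w t‖ ^ 2 ≤ I := by
    rw [intervalIntegral.integral_of_le hT]
    exact setIntegral_mono_set hsq (Eventually.of_forall fun t => by positivity)
      (Set.Ioc_subset_Ioi_self.eventuallyLE)
  calc ‖z T‖ ≤ ∫ t in (0 : ℝ)..T, C * ‖b‖ * (1 + ‖w t‖ ^ 2) := by
        rw [← hFTC]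
        refine intervalIntegral.norm_integral_le_of_norm_le hT
          (Eventually.of_forall fun t ht => ?_) (hint.const_mul _)
        -- This crude bound trades square-integrability of `w` for linear growth of `z`, which is
        -- all that the Laplace transform needs.
        have hwt : ‖w t‖ ≤ 1 + ‖w t‖ ^ 2 := by nlinarith [sq_nonneg (‖w t‖ - 1)]
        calc ‖act (NormedSpace.exp ((T - t) • a)) (act b (w t))‖
            ≤ ‖NormedSpace.exp ((T - t) • a)‖ * (‖b‖ * ‖w t‖) :=
              (norm_act_apply_le _ _).trans (by gcongr; exact norm_act_apply_le _ _)
          _ ≤ C * (‖b‖ * (1 + ‖w t‖ ^ 2)) := by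
              gcongr
              exact hCb _ (by linarith [ht.2])
          _ = _ := by ring
    _ = C * ‖b‖ * (T + ∫ t in (0 : ℝ)..T, ‖w t‖ ^ 2) := by
        have hsq' : IntervalIntegrable (fun t => ‖w t‖ ^ 2) volume 0 T :=
          ((hw.mono hsubset).norm.pow 2).intervalIntegrable_of_Icc hT
        rw [intervalIntegral.integral_const_mul, intervalIntegral.integral_add
          intervalIntegrable_const hsq']
        simp
    _ ≤ C * ‖b‖ * ((1 + I) * (1 + T)) := by
        gcongr
        nlinarith
    _ = _ := by ring

/-- **The `H∞` bound on the `L²` gain** of a stable system with zero initial state. -/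
theorem eLpNorm_output_le {a : Matrix σ σ ℂ} (ha : ∀ z ∈ spectrum ℂ a, z.re < 0)
    {b : Matrix σ ι ℂ} {c : Matrix κ σ ℂ} {d : Matrix κ ι ℂ} {γ : NNReal}
    (hγ : ∀ s : ℂ, 0 < s.re → ‖c * (s • (1 : Matrix σ σ ℂ) - a)⁻¹ * b + d‖ ≤ γ)
    {z : ℝ → EuclideanSpace ℂ σ} {w : ℝ → EuclideanSpace ℂ ι}
    (hw : ContinuousOn w (Set.Ici 0)) (hw₂ : MemLp w 2 (volume.restrict (Set.Ioi 0)))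
    (hz : ∀ t, 0 ≤ t → HasDerivWithinAt z (act a (z t) + act b (w t)) (Set.Ici 0) t)
    (hz0 : z 0 = 0) :
    eLpNorm (fun t => act c (z t) + act d (w t)) 2 (volume.restrict (Set.Ioi 0)) ≤
      γ * eLpNorm w 2 (volume.restrict (Set.Ioi 0)) := by
  obtain ⟨K, hK⟩ := exists_linear_growth ha b hw hw₂ hz hz0
  have hzs : IsSubexponential z :=
    .of_linear_growth (fun t ht => (hz t ht).continuousWithinAt) hK
  have hws : IsSubexponential w := .of_memLp hw₂
  have hys := (hzs.clm_comp (act c)).add (hws.clm_comp (act d))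
  refine eLpNorm_le_of_laplace_le hys.1 (fun η hη => hys.integrable_damp hη)
    (fun η hη => hys.memLp_damp hη) (fun η hη => hws.integrable_damp hη)
    (fun η hη => hws.memLp_damp hη) fun s hs => ?_
  have hlap := laplace_deriv hz hz0 hK ((hzs.clm_comp (act a)).add (hws.clm_comp (act b))) hs
  rw [(hzs.clm_comp (act a)).laplace_add (hws.clm_comp (act b)) hs, hzs.laplace_clm _ hs,
    hws.laplace_clm _ hs] at hlap
  have hunit : IsUnit (s • (1 : Matrix σ σ ℂ) - a) := by
    by_contra h
    refine absurd (ha s ?_) (not_lt.2 hs.le)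
    rwa [spectrum.mem_iff, Algebra.algebraMap_eq_smul_one]
  -- The transformed equation `s ẑ = a ẑ + b ŵ` is solved by inverting `sI - a`, which stability
  -- permits for `Re s > 0`.
  have hZ : laplace z s = act ((s • (1 : Matrix σ σ ℂ) - a)⁻¹ * b) (laplace w s) := by
    rw [act_mul, eq_sub_of_add_eq' hlap]
    have : s • laplace z s - act a (laplace z s) =
        act (s • (1 : Matrix σ σ ℂ) - a) (laplace z s) := by
      rw [map_sub, map_smul]; simp [act_one]
    rw [this, ← act_mul, nonsing_inv_mul _ ((isUnit_iff_isUnit_det _).1 hunit), act_one]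
  rw [(hzs.clm_comp (act c)).laplace_add (hws.clm_comp (act d)) hs, hzs.laplace_clm _ hs,
    hws.laplace_clm _ hs, hZ, ← act_mul, ← Matrix.mul_assoc, ← _root_.add_apply,
    ← map_add]
  exact (norm_act_apply_le _ _).trans (by gcongr; exact hγ s hs)

end LinearSystems

/-! ### Transfer to real systems by complexification -/

section RealSystems

open Filter Topology
open scoped Matrix.Norms.L2Operator

theorem toComplex_mul {σ ι κ : Type*} [Fintype σ] (M : Matrix κ σ ℝ) (N : Matrix σ ι ℝ) :
    toComplex (M * N) = toComplex M * toComplex N :=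
  Matrix.map_mul (f := Complex.ofRealHom)

theorem continuousOn_mulVec {ι κ : Type*} [Fintype ι] (M : Matrix κ ι ℝ) {f : ℝ → ι → ℝ}
    {s : Set ℝ} (hf : ContinuousOn f s) : ContinuousOn (fun t => M *ᵥ f t) s :=
  (Continuous.matrix_mulVec continuous_const continuous_id).comp_continuousOn hf

variable {σ τ ι κ : Type*} [Fintype σ] [Fintype τ] [Fintype ι] [Fintype κ]
  [DecidableEq σ] [DecidableEq τ]

/-- The complexification of a real vector, in Euclidean space. -/
def cvec : (ι → ℝ) →L[ℝ] EuclideanSpace ℂ ι :=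
  LinearMap.toContinuousLinearMap
    { toFun := fun v => WithLp.toLp 2 fun i => (v i : ℂ)
      map_add' := fun v w => by ext i; simp
      map_smul' := fun r v => by ext i; simp }

theorem cvec_apply (v : ι → ℝ) (i : ι) : cvec v i = (v i : ℂ) := rfl

theorem norm_cvec (v : ι → ℝ) : ‖cvec v‖ = ‖WithLp.toLp 2 v‖ := by
  simp [EuclideanSpace.norm_eq, cvec_apply]

theorem act_toComplex [DecidableEq ι] (M : Matrix κ ι ℝ) (v : ι → ℝ) :
    act (toComplex M) (cvec v) = cvec (M *ᵥ v) := by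
  ext i
  simp [act_apply, cvec_apply, toComplex, mulVec, dotProduct]

theorem toComplex_exp (t : ℝ) (A : Matrix σ σ ℝ) :
    toComplex (NormedSpace.exp (t • A)) = NormedSpace.exp (t • toComplex A) := by
  let +nondep : NormedAlgebra ℚ (Matrix σ σ ℝ) := .restrictScalars ℚ ℝ _
  have h := NormedSpace.map_exp (Complex.ofRealHom.mapMatrix (m := σ))
    (Continuous.matrix_map continuous_id Complex.continuous_ofReal) (t • A)
  refine h.trans (congrArg NormedSpace.exp ?_)
  ext i j
  simp [toComplex]

/-- Complexification is isometric and the endpoint `0` is null. -/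
theorem l2Norm_eq (f : ℝ → ι → ℝ) :
    l2Norm f = eLpNorm (fun t => cvec (f t)) 2 (volume.restrict (Set.Ioi 0)) := by
  rw [l2Norm, ← Measure.restrict_congr_set Ioi_ae_eq_Ici]
  exact eLpNorm_congr_norm_ae (Eventually.of_forall fun t => (norm_cvec _).symm)

theorem aestronglyMeasurable_toLp {f : ℝ → ι → ℝ} (hf : ContinuousOn f (Set.Ici 0)) :
    AEStronglyMeasurable (fun t => WithLp.toLp 2 (f t)) (volume.restrict (Set.Ici (0 : ℝ))) :=
  ((PiLp.continuous_toLp 2 _).comp_continuousOn hf).aestronglyMeasurable measurableSet_Ici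

theorem l2Norm_add_le {f g : ℝ → ι → ℝ} (hf : ContinuousOn f (Set.Ici 0))
    (hg : ContinuousOn g (Set.Ici 0)) :
    l2Norm (fun t => f t + g t) ≤ l2Norm f + l2Norm g :=
  eLpNorm_add_le (aestronglyMeasurable_toLp hf) (aestronglyMeasurable_toLp hg) one_le_two

theorem l2Norm_const_smul (r : ℝ) (f : ℝ → ι → ℝ) :
    l2Norm (fun t => r • f t) = ‖r‖ₑ * l2Norm f :=
  eLpNorm_const_smul r (fun t => WithLp.toLp 2 (f t)) 2 _

/-- The `H∞` bound on the `L²` gain of a real stable system with zero initial state. -/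
theorem l2Norm_output_le [DecidableEq ι] {A : Matrix σ σ ℝ} (hA : InternallyStable A)
    {B : Matrix σ ι ℝ} {C : Matrix κ σ ℝ} {D : Matrix κ ι ℝ} {γ : NNReal}
    (hγ : ∀ s : ℂ, 0 < s.re → ‖toComplex C * (s • (1 : Matrix σ σ ℂ) - toComplex A)⁻¹ *
      toComplex B + toComplex D‖ ≤ γ)
    {x : ℝ → σ → ℝ} {w : ℝ → ι → ℝ}
    (hw : ContinuousOn w (Set.Ici 0)) (hw₂ : l2Norm w ≠ ⊤)
    (hx : ∀ t, 0 ≤ t → HasDerivWithinAt x (A *ᵥ x t + B *ᵥ w t) (Set.Ici 0) t)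
    (hx0 : x 0 = 0) :
    l2Norm (fun t => C *ᵥ x t + D *ᵥ w t) ≤ γ * l2Norm w := by
  have hcw : ContinuousOn (fun t => cvec (w t)) (Set.Ici 0) :=
    cvec.continuous.comp_continuousOn hw
  rw [l2Norm_eq] at hw₂
  rw [l2Norm_eq, l2Norm_eq]
  have h := eLpNorm_output_le hA hγ (z := fun t => cvec (x t)) hcw
    ⟨(hcw.mono Set.Ioi_subset_Ici_self).aestronglyMeasurable measurableSet_Ioi, hw₂.lt_top⟩
    (fun t ht => by
      have := cvec.hasFDerivAt.comp_hasDerivWithinAt t (hx t ht)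
      rw [map_add, ← act_toComplex, ← act_toComplex] at this
      exact this)
    (by simp [hx0])
  simpa only [act_toComplex, ← map_add] using h

theorem hasDerivAt_exp_smul_mulVec (A : Matrix σ σ ℝ) (v : σ → ℝ) (t : ℝ) :
    HasDerivAt (fun t : ℝ => NormedSpace.exp (t • A) *ᵥ v)
      (A *ᵥ (NormedSpace.exp (t • A) *ᵥ v)) t := by
  let T : Matrix σ σ ℝ →L[ℝ] σ → ℝ :=
    LinearMap.toContinuousLinearMap ((mulVecBilin ℝ ℝ).flip v)
  have h := T.hasFDerivAt.comp_hasDerivAt t (hasDerivAt_exp_smul_const' A t)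
  rw [mulVec_mulVec]
  exact h

/-- The free response of a stable system has finite `L²` norm. -/
theorem l2Norm_exp_smul_mulVec_ne_top {A : Matrix σ σ ℝ} (hA : InternallyStable A)
    (C : Matrix κ σ ℝ) (E : Matrix σ ι ℝ) (v : ι → ℝ) :
    l2Norm (fun t => (C * NormedSpace.exp (t • A) * E) *ᵥ v) ≠ ⊤ := by
  obtain ⟨K, c, hK, hc, hexp⟩ := exists_norm_exp_smul_le hA
  rw [l2Norm_eq]
  refine ne_top_of_le_ne_top ((memLp_exp_neg hc).const_mul
    (‖toComplex C‖ * K * ‖cvec (E *ᵥ v)‖)).2.ne (eLpNorm_mono_ae ?_)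
  filter_upwards [ae_restrict_mem measurableSet_Ioi] with t ht
  rw [← mulVec_mulVec, ← act_toComplex, toComplex_mul, act_mul, toComplex_exp,
    Real.norm_of_nonneg (by positivity)]
  calc _ ≤ ‖toComplex C‖ * (‖NormedSpace.exp (t • toComplex A)‖ * ‖cvec (E *ᵥ v)‖) :=
        (norm_act_apply_le _ _).trans (by gcongr; exact norm_act_apply_le _ _)
    _ ≤ ‖toComplex C‖ * (K * Real.exp (-c * t) * ‖cvec (E *ᵥ v)‖) := by
        gcongr
        exact hexp t (le_of_lt ht)
    _ = _ := by ring

theorem hInfNorm_ne_top [DecidableEq ι] {A : Matrix σ σ ℝ} (hA : InternallyStable A)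
    (C : Matrix κ σ ℂ) (B : Matrix σ ι ℂ) (D : Matrix κ ι ℂ) :
    hInfNorm (fun s => C * (s • (1 : Matrix σ σ ℂ) - toComplex A)⁻¹ * B + D) ≠ ⊤ := by
  obtain ⟨K, hK⟩ := exists_norm_resolvent_le hA
  refine ne_top_of_le_ne_top (b := ENNReal.ofReal (‖C‖ * K * ‖B‖ + ‖D‖)) ENNReal.ofReal_ne_top
    (iSup_le fun ⟨s, hs⟩ => ?_)
  rw [← ofReal_norm]
  refine ENNReal.ofReal_le_ofReal ((norm_add_le _ _).trans ?_)
  gcongr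
  refine (l2_opNorm_mul _ _).trans ?_
  gcongr
  refine (l2_opNorm_mul _ _).trans ?_
  gcongr
  exact hK s hs

theorem norm_le_of_hInfNorm [DecidableEq ι] {G : ℂ → Matrix κ ι ℂ} (hG : hInfNorm G ≠ ⊤) {s : ℂ}
    (hs : 0 < s.re) : ‖G s‖ ≤ (hInfNorm G).toNNReal := by
  have h : ‖G s‖ₑ ≤ hInfNorm G :=
    le_iSup (fun s : {s : ℂ // 0 < s.re} => ‖G s‖ₑ) ⟨s, hs⟩
  rw [← ENNReal.coe_toNNReal hG] at h
  exact_mod_cast h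

/-- The `L²` norm of an output of a stable system is bounded by the `H∞` norm times the norm of the
input plus the norm of the free response. -/
theorem l2Norm_output_le_add [DecidableEq ι] {A : Matrix σ σ ℝ} (hA : InternallyStable A)
    {B : Matrix σ ι ℝ} {C : Matrix κ σ ℝ} {D : Matrix κ ι ℝ}
    {x : ℝ → σ → ℝ} {w : ℝ → ι → ℝ}
    (hw : ContinuousOn w (Set.Ici 0)) (hw₂ : l2Norm w ≠ ⊤)
    (hx : ∀ t, 0 ≤ t → HasDerivWithinAt x (A *ᵥ x t + B *ᵥ w t) (Set.Ici 0) t) :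
    l2Norm (fun t => C *ᵥ x t + D *ᵥ w t) ≤
      hInfNorm (fun s => toComplex C * (s • (1 : Matrix σ σ ℂ) - toComplex A)⁻¹ *
        toComplex B + toComplex D) * l2Norm w +
      l2Norm (fun t => (C * NormedSpace.exp (t • A)) *ᵥ x 0) := by
  have hfin := hInfNorm_ne_top hA (toComplex C) (toComplex B) (toComplex D)
  have hfree := hasDerivAt_exp_smul_mulVec A (x 0)
  -- Subtracting the free response leaves the forced motion with zero initial state.
  set p : ℝ → σ → ℝ := fun t => x t - NormedSpace.exp (t • A) *ᵥ x 0 with hp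
  have hpd : ∀ t, 0 ≤ t → HasDerivWithinAt p (A *ᵥ p t + B *ᵥ w t) (Set.Ici 0) t :=
    fun t ht => ((hx t ht).sub (hfree t).hasDerivWithinAt).congr_deriv (by
      simp only [hp, mulVec_sub]; abel)
  have hforced := l2Norm_output_le hA (C := C) (D := D)
    (fun s hs => norm_le_of_hInfNorm hfin hs) hw hw₂ hpd (by simp [hp])
  rw [ENNReal.coe_toNNReal hfin] at hforced
  have hsplit : (fun t => C *ᵥ x t + D *ᵥ w t) = fun t =>
      (C *ᵥ p t + D *ᵥ w t) + (C * NormedSpace.exp (t • A)) *ᵥ x 0 := by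
    funext t
    simp only [hp, mulVec_sub, ← mulVec_mulVec]
    abel
  rw [hsplit]
  refine (l2Norm_add_le ?_ ?_).trans (add_le_add_left hforced _)
  · exact (continuousOn_mulVec C fun t ht => (hpd t ht).continuousWithinAt).add (continuousOn_mulVec D hw)
  · simp only [← mulVec_mulVec]
    exact continuousOn_mulVec C fun t _ => (hfree t).continuousAt.continuousWithinAt

/-- The characteristic polynomial of a block triangular matrix is the product of those of the
diagonal blocks. -/
theorem internallyStable_fromBlocks_zero₁₂ (M : Matrix σ σ ℝ) (N : Matrix τ σ ℝ)
    (A : Matrix τ τ ℝ) :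
    InternallyStable (fromBlocks M 0 N A) ↔ InternallyStable M ∧ InternallyStable A := by
  have h : toComplex (fromBlocks M 0 N A) =
      fromBlocks (toComplex M) 0 (toComplex N) (toComplex A) := by
    simp [toComplex, fromBlocks_map]
  simp only [InternallyStable, h, mem_spectrum_iff_isRoot_charpoly, charpoly_fromBlocks_zero₁₂,
    Polynomial.root_mul, or_imp, forall_and]

end RealSystems

/-! ### The hierarchical realization -/

section Hierarchical

variable {n₁ n₂ m₁ p₁ p₂ nh₁ : ℕ}

theorem E₁_transpose_mulVec (a : Fin n₁ → ℝ) (b : Fin n₂ → ℝ) :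
    (E₁ n₁ n₂)ᵀ *ᵥ Sum.elim a b = a := by
  simp [E₁, transpose_fromRows]

theorem E₂_transpose_mulVec (a : Fin n₁ → ℝ) (b : Fin n₂ → ℝ) :
    (E₂ n₁ n₂)ᵀ *ᵥ Sum.elim a b = b := by
  simp [E₂, transpose_fromRows]

theorem E₁_mulVec (a : Fin n₁ → ℝ) : E₁ n₁ n₂ *ᵥ a = Sum.elim a 0 := by
  simp [E₁, fromRows_mulVec]

namespace Preexisting

variable (S : Preexisting n₁ n₂ m₁ p₁ p₂) (R : Projection n₁ nh₁)

theorem hierarchicalClosedLoop_eq (K : Matrix (Fin m₁) (Fin nh₁) ℝ) :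
    S.hierarchicalClosedLoop R K =
      fromBlocks (R.Pd * S.A₁ * R.P + R.Pd * S.B₁ * K) 0 ((S.downstream R).B * R.P) S.A := by
  have h : fromRows (R.Pd * S.B₁) (0 : Matrix (Fin n₁ ⊕ Fin n₂) (Fin m₁) ℝ) *
      fromCols K (0 : Matrix (Fin m₁) (Fin n₁ ⊕ Fin n₂) ℝ) =
      Matrix.fromBlocks (R.Pd * S.B₁ * K) 0 0 0 := by
    rw [fromRows_mul_fromCols]; simp
  rw [hierarchicalClosedLoop, LTISystem.closedLoop, hierarchical, LTISystem.cascade]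
  dsimp only [upstream]
  rw [h, fromBlocks_add, add_zero, add_zero, add_zero]
  rfl

/-- Absorbing `P` into the input matrix and the feedthrough presents this as the transfer matrix
from `ξ̂₁` to `ξ₁ + P ξ̂₁`. -/
theorem α₁_eq : S.α₁ R = hInfNorm fun s => toComplex (E₁ n₁ n₂)ᵀ *
    (s • (1 : Matrix (Fin n₁ ⊕ Fin n₂) (Fin n₁ ⊕ Fin n₂) ℂ) - toComplex S.A)⁻¹ *
    toComplex ((S.downstream R).B * R.P) + toComplex R.P := by
  simp only [α₁, G₁, LTISystem.transfer, toComplex_mul, Matrix.add_mul, Matrix.one_mul,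
    Matrix.mul_assoc]
  rfl

theorem α₂_eq : S.α₂ R = hInfNorm fun s => toComplex (E₂ n₁ n₂)ᵀ *
    (s • (1 : Matrix (Fin n₁ ⊕ Fin n₂) (Fin n₁ ⊕ Fin n₂) ℂ) - toComplex S.A)⁻¹ *
    toComplex ((S.downstream R).B * R.P) + toComplex (0 : Matrix (Fin n₂) (Fin nh₁) ℝ) := by
  have h0 : toComplex (0 : Matrix (Fin n₂) (Fin nh₁) ℝ) = 0 := by simp [toComplex]
  simp only [α₂, G₂, LTISystem.transfer, toComplex_mul, h0, add_zero, Matrix.mul_assoc]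
  rfl

theorem _root_.Retrofit.IsSolution.fromBlocks {σ τ : Type*} [Fintype σ] [Fintype τ]
    {M : Matrix σ σ ℝ} {N : Matrix τ σ ℝ} {A : Matrix τ τ ℝ} {x : ℝ → σ → ℝ} {y : ℝ → τ → ℝ}
    (h : IsSolution (fromBlocks M 0 N A) fun t => Sum.elim (x t) (y t)) :
    IsSolution M x ∧
      ∀ t, 0 ≤ t → HasDerivWithinAt y (A *ᵥ y t + N *ᵥ x t) (Set.Ici 0) t := by
  refine ⟨fun t ht => ?_, fun t ht => ?_⟩ <;>
  · have h' := h t ht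
    rw [fromBlocks_mulVec, hasDerivWithinAt_pi] at h'
    rw [hasDerivWithinAt_pi]
    intro i
    first
    | simpa using h' (Sum.inl i)
    | simpa [add_comm] using h' (Sum.inr i)

/-- By linearity, dividing the solution by `1 + ‖ζ₀‖` brings its initial datum `δ₀ - ζ₀` into the
unit ball, where the specification applies. -/
theorem l2Norm_le_of_specification {K : Matrix (Fin m₁) (Fin nh₁) ℝ} {ε : ℝ}
    (hspec : S.Specification R K ε) {ξh : ℝ → Fin nh₁ → ℝ}
    (hξ : IsSolution (R.Pd * S.A₁ * R.P + R.Pd * S.B₁ * K) ξh) {δ₀ ζ₀ : Fin n₁ → ℝ}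
    (hδ : euclNorm δ₀ ≤ 1) (h0 : ξh 0 = R.Pd *ᵥ (δ₀ - ζ₀)) :
    l2Norm ξh ≤ ENNReal.ofReal ((1 + euclNorm ζ₀) * ε) := by
  set c := 1 + euclNorm ζ₀ with hc
  have hc0 : 0 < c := by
    have : 0 ≤ euclNorm ζ₀ := norm_nonneg _
    linarith
  have hscaled := hspec (fun t => c⁻¹ • ξh t)
    (fun t ht => by rw [mulVec_smul]; exact (hξ t ht).const_smul c⁻¹)
    ⟨c⁻¹ • (δ₀ - ζ₀), by
      rw [euclNorm, WithLp.toLp_smul, norm_smul, Real.norm_of_nonneg (by positivity),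
        inv_mul_le_one₀ hc0, WithLp.toLp_sub]
      exact (norm_sub_le _ _).trans (add_le_add_left hδ _),
      by rw [h0, mulVec_smul]⟩
  have heq : ξh = fun t => c • c⁻¹ • ξh t := by
    funext t; rw [smul_inv_smul₀ hc0.ne']
  rw [heq, l2Norm_const_smul, Real.enorm_of_nonneg hc0.le, ENNReal.ofReal_mul hc0.le]
  gcongr

end Preexisting

end Hierarchical

end

end Retrofit

/-! ### Assembly -/

open Retrofit Matrix in
theorem lemma4 {n₁ n₂ m₁ p₁ p₂ nh₁ : ℕ}
    (S : Preexisting n₁ n₂ m₁ p₁ p₂) (R : Projection n₁ nh₁)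
    (hA : InternallyStable S.A) :
    (∀ K : Matrix (Fin m₁) (Fin nh₁) ℝ,
      InternallyStable (S.hierarchicalClosedLoop R K) ↔
        InternallyStable (R.Pd * S.A₁ * R.P + R.Pd * S.B₁ * K)) ∧
    (S.α₁ R ≠ ⊤ ∧ S.α₂ R ≠ ⊤) ∧
    (∀ δ₀ ζ₀ : Fin n₁ → ℝ, S.β₁ R δ₀ ζ₀ ≠ ⊤ ∧ S.β₂ R δ₀ ζ₀ ≠ ⊤) ∧
    (∀ (K : Matrix (Fin m₁) (Fin nh₁) ℝ) (ε₁ : ℝ), 0 < ε₁ → S.Specification R K ε₁ →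
      ∀ ζ₀ δ₀ : Fin n₁ → ℝ, euclNorm δ₀ ≤ 1 →
      ∀ (ξh : ℝ → Fin nh₁ → ℝ) (ξ₁ : ℝ → Fin n₁ → ℝ) (ξ₂ : ℝ → Fin n₂ → ℝ),
        S.IsResponse R K δ₀ ζ₀ ξh ξ₁ ξ₂ →
        l2Norm (fun t => ξ₁ t + R.P *ᵥ ξh t) ≤
            S.α₁ R * ENNReal.ofReal ((1 + euclNorm ζ₀) * ε₁) + S.β₁ R δ₀ ζ₀ ∧
        l2Norm ξ₂ ≤
            S.α₂ R * ENNReal.ofReal ((1 + euclNorm ζ₀) * ε₁) + S.β₂ R δ₀ ζ₀) := by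
  refine ⟨fun K => ?_, ⟨?_, ?_⟩, fun δ₀ ζ₀ => ⟨?_, ?_⟩, ?_⟩
  · rw [S.hierarchicalClosedLoop_eq R K, internallyStable_fromBlocks_zero₁₂, and_iff_left hA]
  · rw [S.α₁_eq R]
    exact hInfNorm_ne_top hA _ _ _
  · rw [S.α₂_eq R]
    exact hInfNorm_ne_top hA _ _ _
  · exact l2Norm_exp_smul_mulVec_ne_top hA _ _ _
  · exact l2Norm_exp_smul_mulVec_ne_top hA _ _ _
  · intro K ε₁ _ hspec ζ₀ δ₀ hδ ξh ξ₁ ξ₂ hξ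
    have hsol := hξ.solution
    rw [S.hierarchicalClosedLoop_eq R K] at hsol
    obtain ⟨hup, hdown⟩ := hsol.fromBlocks
    have hle := S.l2Norm_le_of_specification R hspec hup hδ hξ.init_up
    have hcont : ContinuousOn ξh (Set.Ici 0) := fun t ht => (hup t ht).continuousWithinAt
    -- The gain bound needs a square-integrable input; this comes from the specification, as `K` is
    -- not assumed stabilizing.
    have hfin : l2Norm ξh ≠ ⊤ := ne_top_of_le_ne_top ENNReal.ofReal_ne_top hle
    have hinit : Sum.elim (ξ₁ 0) (ξ₂ 0) = E₁ n₁ n₂ *ᵥ R.init₁ δ₀ ζ₀ := by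
      rw [hξ.init_one, hξ.init_two, E₁_mulVec]
    constructor
    · have h := l2Norm_output_le_add hA (C := (E₁ n₁ n₂)ᵀ) (D := R.P) hcont hfin hdown
      simp only [E₁_transpose_mulVec, hinit, mulVec_mulVec] at h
      rw [← S.α₁_eq R] at h
      exact h.trans (by gcongr; exact le_rfl)
    · have h := l2Norm_output_le_add hA (C := (E₂ n₁ n₂)ᵀ) (D := 0) hcont hfin hdown
      simp only [E₂_transpose_mulVec, hinit, mulVec_mulVec, zero_mulVec, add_zero] at h
      rw [← S.α₂_eq R] at h
      exact h.trans (by gcongr; exact le_rfl)
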